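/- A subspace of $\mathbb R^n$ is called rational if it has a basis of vectors with rational coordinates; let $\mathfrak R_n(e)$ be the set of rational subspaces of $\mathbb R^n$ of dimension $e$. The height $H(B)$ of $B\in\mathfrak R_n(e)$ is the Euclidean norm of a vector of Plücker coordinates of $B$ whose coordinates are setwise coprime integers. For nonzero $X,Y\in\mathbb R^n$ (with the standard Euclidean structure) let $\psi(X,Y)$ be the sine of the angle between $X$ and $Y$. For subspaces $A,B$ of $\mathbb R^n$ of dimensions $d,e$, define inductively $\psi_1(A,B),\dots,\psi_{\min(d,e)}(A,B)$: if unit vectors $X_1,\dots,X_i\in A$ and $Y_1,\dots,Y_i\in B$ have been chosen, let $A_i$ be the orthogonal complement of $\mathrm{span}(X_1,\dots,X_i)$ in $A$ and $B_i$ that of $\mathrm{span}(Y_1,\dots,Y_i)$ in $B$, let $$\psi_{i+1}(A,B)=\min_{X\in A_i\setminus\{0\},\ Y\in B_i\setminus\{0\}}\psi(X,Y),$$ and let $X_{i+1},Y_{i+1}$ be unit vectors attaining this minimum (the numbers $\psi_j(A,B)$ do not depend on the choices). Let $\mathfrak I_n(d,e)_j$ be the set of subspaces $A$ of $\mathbb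 R^n$ of dimension $d$ such that $\dim(A\cap B)<j$ for all $B\in\mathfrak R_n(e)$. For such $A$ let $\mu_n(A|e)_j\in[0,+\infty]$ be the supremum of the $\beta>0$ such that $\psi_j(A,B)\le H(B)^{-\beta}$ for infinitely many $B\in\mathfrak R_n(e)$, and let $$\mathring\mu_n(d|e)_j=\inf_{A\in\mathfrak I_n(d,e)_j}\mu_n(A|e)_j .$$ **Theorem.** Let $n\ge 4$ and let $d,e\in\{1,\dots,n-1\}$ be such that $d+e\le n$; let $j\in\{1,\dots,\min(d,e)\}$. Then $$\mathring\mu_n(d|e)_j\ \ge\ \frac{(n-j)\left(jn-jd+\frac{j^2}{2}+\frac j2+1\right)}{j^2\,(n-e)\left(n-d+\frac j2+\frac12\right)} .$$ -/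

import Mathlib

/-- The Euclidean space `ℝⁿ`. -/
abbrev EucSp (n : ℕ) : Type := EuclideanSpace ℝ (Fin n)

/-- The set of rational subspaces of dimension `e` of `ℝⁿ`: those having a basis of `e` vectors
with rational coordinates. -/
def rationalSubspaces (n e : ℕ) : Set (Submodule ℝ (EucSp n)) :=
  {B | ∃ b : Module.Basis (Fin e) ℝ B, ∀ k i, ∃ q : ℚ, (b k : EucSp n) i = (q : ℝ)}

/-- The set of `(e, j)`-irrational subspaces of dimension `d` of `ℝⁿ`. -/
def irrationalSubspaces (n d e j : ℕ) : Set (Submodule ℝ (EucSp n)) :=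
  {A | Module.finrank ℝ A = d ∧
    ∀ B ∈ rationalSubspaces n e, Module.finrank ℝ (A ⊓ B : Submodule ℝ (EucSp n)) < j}

/-- The Plücker coordinates of a family `v` of `e` vectors of `ℝⁿ`: its minors of size `e`, indexed
by the increasing `e`-tuples of indices. -/
noncomputable def pluckerCoord {n e : ℕ} (v : Fin e → EucSp n) (I : Fin e ↪o Fin n) : ℝ :=
  Matrix.det (Matrix.of fun k l : Fin e => v k (I l))

/-- `Ξ` is an integer vector with setwise coprime coordinates in the (projective) class of Plücker
coordinates of the `e`-dimensional subspace `B`. -/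
def IsPrimitivePlucker {n e : ℕ} (B : Submodule ℝ (EucSp n)) (Ξ : (Fin e ↪o Fin n) → ℤ) : Prop :=
  Finset.univ.gcd Ξ = 1 ∧
    ∃ b : Module.Basis (Fin e) ℝ B, ∃ c : ℝ, c ≠ 0 ∧
      ∀ I, (Ξ I : ℝ) = c * pluckerCoord (fun k => (b k : EucSp n)) I

/-- The height `H(B)` of a rational subspace `B` of dimension `e`: the Euclidean norm of any
primitive integer vector of Plücker coordinates of `B` (see `exists_isPrimitivePlucker` and
`IsPrimitivePlucker.height_eq`: for `B` rational of dimension `e` such a vector exists, and the set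
below is a singleton). -/
noncomputable def height {n : ℕ} (e : ℕ) (B : Submodule ℝ (EucSp n)) : ℝ :=
  sInf {h | ∃ Ξ : (Fin e ↪o Fin n) → ℤ, IsPrimitivePlucker B Ξ ∧ h = √(∑ I, (Ξ I : ℝ) ^ 2)}

/-- Some minor of maximal size of a basis is nonzero. -/
theorem exists_pluckerCoord_ne_zero {n e : ℕ} {B : Submodule ℝ (EucSp n)}
    (b : Module.Basis (Fin e) ℝ B) : ∃ I, pluckerCoord (fun k => (b k : EucSp n)) I ≠ 0 := by
  classical
  set M : Matrix (Fin e) (Fin n) ℝ := Matrix.of fun k i => (b k : EucSp n) i with hM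
  have hli : LinearIndependent ℝ M.row := by
    have h1 := b.linearIndependent.map' B.subtype (Submodule.ker_subtype B)
    exact h1.map' (WithLp.linearEquiv 2 ℝ (Fin n → ℝ)).toLinearMap (LinearEquiv.ker _)
  have hr : Module.finrank ℝ (Submodule.span ℝ (Set.range M.col)) = e := by
    have := hli.rank_matrix
    rw [Matrix.rank_eq_finrank_span_cols] at this
    simpa using this
  obtain ⟨f, hf, -, hfi⟩ := Submodule.exists_fun_fin_finrank_span_eq ℝ (Set.range M.col)
  choose g hg using hf
  have hginj : Function.Injective g := fun x y h => hfi.injective (by rw [← hg, ← hg, h])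
  have hcard : (Finset.univ.image g).card = e := by
    rw [Finset.card_image_of_injective _ hginj]; simpa using hr
  let I : Fin e ↪o Fin n := (Finset.univ.image g).orderEmbOfFin hcard
  have hI : ∀ l, ∃ k, g k = I l := fun l => by
    obtain ⟨k, -, hk⟩ := Finset.mem_image.1 ((Finset.univ.image g).orderEmbOfFin_mem hcard l)
    exact ⟨k, hk⟩
  choose s hs using hI
  have hsinj : Function.Injective s := fun x y h => I.injective (by rw [← hs, ← hs, h])
  refine ⟨I, ?_⟩
  have hc : LinearIndependent ℝ (Matrix.of fun k l : Fin e => (b k : EucSp n) (I l)).col := by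
    have h1 : f ∘ s = (Matrix.of fun k l : Fin e => (b k : EucSp n) (I l)).col := by
      funext l
      simp only [Function.comp, ← hg, hs]
      rfl
    exact h1 ▸ hfi.comp s hsinj
  have := (Matrix.linearIndependent_cols_iff_isUnit.1 hc)
  rw [Matrix.isUnit_iff_isUnit_det] at this
  exact this.ne_zero

/-- A rational subspace has a primitive integer vector of Plücker coordinates. -/
theorem exists_isPrimitivePlucker {n e : ℕ} {B : Submodule ℝ (EucSp n)}
    (hB : B ∈ rationalSubspaces n e) : ∃ Ξ : (Fin e ↪o Fin n) → ℤ, IsPrimitivePlucker B Ξ := by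
  classical
  obtain ⟨b, hb⟩ := hB
  choose q hq using hb
  let r : (Fin e ↪o Fin n) → ℚ := fun I => Matrix.det (Matrix.of fun k l : Fin e => q k (I l))
  have hr : ∀ I, pluckerCoord (fun k => (b k : EucSp n)) I = (r I : ℝ) := fun I => by
    simp only [pluckerCoord, r, hq]
    exact (RingHom.map_det (algebraMap ℚ ℝ) _).symm
  obtain ⟨m, hm⟩ := IsLocalization.exist_integer_multiples_of_finite (nonZeroDivisors ℤ) r
  have hm0 : (m : ℤ) ≠ 0 := nonZeroDivisors.ne_zero m.2
  choose z hz using hm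
  have hz' : ∀ I, (z I : ℝ) = (m : ℤ) * pluckerCoord (fun k => (b k : EucSp n)) I := fun I => by
    have h1 : (z I : ℚ) = (m : ℤ) * r I := by simpa using hz I
    rw [hr]
    exact_mod_cast h1
  obtain ⟨I, hI⟩ := exists_pluckerCoord_ne_zero b
  have hzI : z I ≠ 0 := fun h => by
    have := hz' I
    rw [h] at this
    simp [hI, hm0] at this
  obtain ⟨Ξ, h1, h2⟩ := Finset.extract_gcd z ⟨I, Finset.mem_univ I⟩
  have hg : Finset.univ.gcd z ≠ 0 := fun h => hzI (by rw [h1 I (Finset.mem_univ I), h, zero_mul])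
  refine ⟨Ξ, h2, b, (m : ℤ) / (Finset.univ.gcd z : ℤ), ?_, fun J => ?_⟩
  · have : ((Finset.univ.gcd z : ℤ) : ℝ) ≠ 0 := by exact_mod_cast hg
    have : ((m : ℤ) : ℝ) ≠ 0 := by exact_mod_cast hm0
    positivity
  · have hg' : ((Finset.univ.gcd z : ℤ) : ℝ) ≠ 0 := by exact_mod_cast hg
    have h3 : (z J : ℝ) = (Finset.univ.gcd z : ℤ) * (Ξ J : ℝ) := by
      exact_mod_cast h1 J (Finset.mem_univ J)
    rw [hz'] at h3
    field_simp
    linarith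

/-- The Plücker coordinates of two bases are proportional. -/
theorem pluckerCoord_basis {n e : ℕ} {B : Submodule ℝ (EucSp n)} (b b' : Module.Basis (Fin e) ℝ B)
    (I : Fin e ↪o Fin n) : pluckerCoord (fun k => (b' k : EucSp n)) I =
      (b.toMatrix b').det * pluckerCoord (fun k => (b k : EucSp n)) I := by
  unfold pluckerCoord
  rw [← Matrix.det_transpose (b.toMatrix b'), ← Matrix.det_mul]
  congr 1
  ext k l
  have := congrArg (fun v : B => (v : EucSp n) (I l)) (b.sum_toMatrix_smul_self b' k)
  simp only [Submodule.coe_sum, Submodule.coe_smul] at this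
  simp [Matrix.mul_apply, ← this]

/-- The norm of a primitive vector of Plücker coordinates does not depend on its choice. -/
theorem IsPrimitivePlucker.height_eq {n e : ℕ} {B : Submodule ℝ (EucSp n)}
    {Ξ : (Fin e ↪o Fin n) → ℤ} (h : IsPrimitivePlucker B Ξ) :
    height e B = √(∑ I, (Ξ I : ℝ) ^ 2) := by
  have key : ∀ Ξ', IsPrimitivePlucker B Ξ' → ∀ I, Ξ' I ^ 2 = Ξ I ^ 2 := by
    rintro Ξ' ⟨hg', b', c', hc', hp'⟩
    obtain ⟨hg, b, c, hc, hp⟩ := h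
    have h1 : ∀ I, (Ξ' I : ℝ) = (c' * (b.toMatrix b').det / c) * Ξ I := fun I => by
      rw [hp', hp, pluckerCoord_basis b b']; field_simp
    obtain ⟨u, hu⟩ := Finset.gcd_eq_sum_mul Finset.univ Ξ
    rw [hg] at hu
    have h2 : c' * (b.toMatrix b').det / c = ((∑ I, Ξ' I * u I : ℤ) : ℝ) := by
      have hu' : (1 : ℝ) = ∑ I, (Ξ I : ℝ) * u I := by exact_mod_cast hu
      push_cast
      simp only [h1, mul_assoc, ← Finset.mul_sum]
      rw [← hu', mul_one]
    rw [h2] at h1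
    set m := ∑ I, Ξ' I * u I
    have h3 : ∀ I, Ξ' I = m * Ξ I := fun I => by exact_mod_cast h1 I
    have h4 : m ∣ 1 := hg' ▸ Finset.dvd_gcd fun I _ => ⟨_, h3 I⟩
    have h5 : m ^ 2 = 1 := by
      rcases Int.isUnit_iff.1 (isUnit_of_dvd_one h4) with h | h <;> simp [h]
    intro I
    rw [h3, mul_pow, h5, one_mul]
  have : {x | ∃ Ξ : (Fin e ↪o Fin n) → ℤ, IsPrimitivePlucker B Ξ ∧ x = √(∑ I, (Ξ I : ℝ) ^ 2)} =
      {√(∑ I, (Ξ I : ℝ) ^ 2)} := by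
    ext x
    simp only [Set.mem_ofPred_eq, Set.mem_singleton_iff]
    constructor
    · rintro ⟨Ξ', h', rfl⟩
      congr 1
      exact Finset.sum_congr rfl fun I _ => by exact_mod_cast key Ξ' h' I
    · rintro rfl
      exact ⟨Ξ, h, rfl⟩
  rw [height, this, csInf_singleton]

/-- The distance `ψ(X, Y)` between two nonzero vectors: the sine of their angle. -/
noncomputable def psiVec {n : ℕ} (X Y : EucSp n) : ℝ :=
  Real.sin (InnerProductGeometry.angle X Y)

/-- The orthogonal complement, in `A`, of the span of `X 1, …, X i`. -/
noncomputable def remainder {n : ℕ} (A : Submodule ℝ (EucSp n)) (X : ℕ → EucSp n) (i : ℕ) :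
    Submodule ℝ (EucSp n) :=
  A ⊓ (Submodule.span ℝ (X '' Set.Icc 1 i))ᗮ

/-- `(X 1, Y 1), …, (X j, Y j)` are pairs of unit vectors produced by the inductive construction of
the canonical angles between `A` and `B`: for `i < j`, the pair `(X (i + 1), Y (i + 1))` minimizes
`ψ` among the pairs of nonzero vectors of `A` and `B` orthogonal to `X 1, …, X i` and to
`Y 1, …, Y i` respectively. (Only the values of `X` and `Y` at `1, …, j` matter.) -/
def IsCanonicalPairs {n : ℕ} (A B : Submodule ℝ (EucSp n)) (j : ℕ) (X Y : ℕ → EucSp n) : Prop :=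
  ∀ i < j, X (i + 1) ∈ remainder A X i ∧ Y (i + 1) ∈ remainder B Y i ∧
    ‖X (i + 1)‖ = 1 ∧ ‖Y (i + 1)‖ = 1 ∧
    ∀ x ∈ remainder A X i, ∀ y ∈ remainder B Y i, x ≠ 0 → y ≠ 0 →
      psiVec (X (i + 1)) (Y (i + 1)) ≤ psiVec x y

/-- The inductive construction of the canonical angles can be carried out. -/
theorem exists_isCanonicalPairs {n : ℕ} (A B : Submodule ℝ (EucSp n)) (j : ℕ)
    (hA : j ≤ Module.finrank ℝ A) (hB : j ≤ Module.finrank ℝ B) :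
    ∃ X Y : ℕ → EucSp n, IsCanonicalPairs A B j X Y := by
  induction j with
  | zero => exact ⟨0, 0, fun i hi => absurd hi (Nat.not_lt_zero i)⟩
  | succ j ih =>
    obtain ⟨X, Y, hXY⟩ := ih (by omega) (by omega)
    have hex : ∀ (C : Submodule ℝ (EucSp n)) (Z : ℕ → EucSp n), j + 1 ≤ Module.finrank ℝ C →
        ∃ z ∈ remainder C Z j, ‖z‖ = 1 := by
      intro C Z hC
      have h0 : remainder C Z j ≠ ⊥ := by
        intro h
        set S := Submodule.span ℝ (Z '' Set.Icc 1 j) with hS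
        have h1 : Module.finrank ℝ S ≤ j := by
          have h := finrank_span_finset_le_card (R := ℝ) ((Finset.Icc 1 j).image Z)
          have h' := Finset.card_image_le (s := Finset.Icc 1 j) (f := Z)
          rw [Nat.card_Icc, Nat.add_sub_cancel] at h'
          rw [Finset.coe_image, Finset.coe_Icc] at h
          exact h.trans h'
        have h2 := S.finrank_add_finrank_orthogonal
        have h3 := Submodule.finrank_sup_add_finrank_inf_eq C Sᗮ
        have h4 := Submodule.finrank_le (C ⊔ Sᗮ)
        have h5 : C ⊓ Sᗮ = ⊥ := h
        rw [h5, finrank_bot] at h3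
        omega
      obtain ⟨z, hz, hz0⟩ := Submodule.exists_mem_ne_zero_of_ne_bot h0
      exact ⟨(‖z‖⁻¹ : ℝ) • z, Submodule.smul_mem _ _ hz, by
        rw [norm_smul, norm_inv, norm_norm, inv_mul_cancel₀ (norm_ne_zero_iff.2 hz0)]⟩
    obtain ⟨x₀, hx₀, hx₀'⟩ := hex A X hA
    obtain ⟨y₀, hy₀, hy₀'⟩ := hex B Y hB
    have hcpt : ∀ C : Submodule ℝ (EucSp n),
        IsCompact ((C : Set (EucSp n)) ∩ Metric.sphere 0 1) := fun C =>
      (isCompact_sphere _ _).inter_left C.closed_of_finiteDimensional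
    obtain ⟨⟨x, y⟩, ⟨⟨hx, hx1⟩, hy, hy1⟩, hmin⟩ :=
      ((hcpt (remainder A X j)).prod (hcpt (remainder B Y j))).exists_isMinOn
        (f := fun p : EucSp n × EucSp n => psiVec p.1 p.2)
        ⟨(x₀, y₀), ⟨hx₀, by simpa using hx₀'⟩, hy₀, by simpa using hy₀'⟩
        (by
          rintro ⟨x, y⟩ ⟨⟨-, hx1⟩, -, hy1⟩
          refine (Real.continuous_sin.continuousAt.comp
            (InnerProductGeometry.continuousAt_angle (x := (x, y)) ?_ ?_)).continuousWithinAt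
          · rintro rfl; simp at hx1
          · rintro rfl; simp at hy1)
    rw [mem_sphere_zero_iff_norm] at hx1 hy1
    have hrem : ∀ (C : Submodule ℝ (EucSp n)) (Z : ℕ → EucSp n) (z : EucSp n), ∀ i ≤ j,
        remainder C (Function.update Z (j + 1) z) i = remainder C Z i := by
      intro C Z z i hi
      unfold remainder
      congr 3
      refine Set.image_congr fun k hk => Function.update_of_ne ?_ _ _
      have := hk.2
      omega
    refine ⟨Function.update X (j + 1) x, Function.update Y (j + 1) y, fun i hi => ?_⟩
    rw [hrem A X x i (by omega), hrem B Y y i (by omega)]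
    rcases Nat.lt_succ_iff_lt_or_eq.1 hi with h | rfl
    · rw [Function.update_of_ne (by omega), Function.update_of_ne (by omega)]
      exact hXY i h
    · rw [Function.update_self, Function.update_self]
      refine ⟨hx, hy, hx1, hy1, fun u hu v hv hu0 hv0 => ?_⟩
      have hu1 : (0 : ℝ) < ‖u‖⁻¹ := by positivity
      have hv1 : (0 : ℝ) < ‖v‖⁻¹ := by positivity
      have := hmin (a := ((‖u‖⁻¹ : ℝ) • u, (‖v‖⁻¹ : ℝ) • v))
        ⟨⟨Submodule.smul_mem _ _ hu, by
            simp [norm_smul, inv_mul_cancel₀ (norm_ne_zero_iff.2 hu0)]⟩,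
          Submodule.smul_mem _ _ hv, by
            simp [norm_smul, inv_mul_cancel₀ (norm_ne_zero_iff.2 hv0)]⟩
      simpa [psiVec, InnerProductGeometry.angle_smul_left_of_pos _ _ hu1,
        InnerProductGeometry.angle_smul_right_of_pos _ _ hv1] using this

/-- `ψ_j(A, B)`, for `1 ≤ j ≤ min (dim A) (dim B)`: the value `ψ(X_j, Y_j)` for pairs
`(X_1, Y_1), …, (X_j, Y_j)` as above. Such pairs exist (`exists_isCanonicalPairs`), and the value
does not depend on them. -/
noncomputable def psi {n : ℕ} (j : ℕ) (A B : Submodule ℝ (EucSp n)) : ℝ :=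
  sInf {r | ∃ X Y : ℕ → EucSp n, IsCanonicalPairs A B j X Y ∧ r = psiVec (X j) (Y j)}

/-- The exponent `μ_n(A|e)_j`: the supremum, in the extended reals, of the `β > 0` such that
`ψ_j(A, B) ≤ H(B)^{-β}` for infinitely many rational subspaces `B` of dimension `e`. -/
noncomputable def muExp {n : ℕ} (A : Submodule ℝ (EucSp n)) (e j : ℕ) : EReal :=
  sSup {x | ∃ β : ℝ, 0 < β ∧
    {B ∈ rationalSubspaces n e | psi j A B ≤ 1 / height e B ^ β}.Infinite ∧ x = (β : EReal)}

/-- `μ̊_n(d|e)_j`: the infimum of `μ_n(A|e)_j` over the `(e, j)`-irrational subspaces `A` of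
dimension `d`. -/
noncomputable def muRing (n d e j : ℕ) : EReal :=
  sInf {x | ∃ A ∈ irrationalSubspaces n d e j, x = muExp A e j}

/-! Fix `A` and approximate a `j`-dimensional piece of it. In an echelon basis of `A`, `j` of the
vectors have `j(n-d)` free coordinates in all. Dirichlet's theorem gives `q ≤ Q^{j(n-d)}` and
integer vectors within `O(1/Q)` of `q` times these basis vectors. Their span `B` has height
`O(q^j)`, and its vectors lie at relative distance `O(1/(qQ))` from `A` (`exists_rational_near`).

Then `B` is enlarged to a rational `C` of dimension `e` with `H(C)^{n-j} ≪ H(B)^{n-e}`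
(`exists_rational_of_le`). As `C` contains `B`, `ψ_j(A, C) ≪ 1/(qQ)` (`psi_le`). Since `Q ≥
q^{1/(j(n-d))}`, every exponent below `(n-j)(1+1/(j(n-d)))/(j(n-e))` is reached. The stated bound
has `N = j(n-d) + j(j+1)/2` in place of `j(n-d)` inside the parenthesis; this slack absorbs all
constants.

Infinitely many `C` occur: `dim(A ∩ C) < j = dim B`, so `B` contains a nonzero vector orthogonal to
`A ∩ C`, whose relative distance to `A` is at least a positive constant depending only on `C`. A
fixed `C` thus serves only boundedly many `Q`. -/

/-! ### Canonical angles and distance to `A`. -/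

theorem psiVec_nonneg {n : ℕ} (x y : EucSp n) : 0 ≤ psiVec x y :=
  InnerProductGeometry.sin_angle_nonneg x y

theorem psiVec_sq_mul {n : ℕ} (x y : EucSp n) :
    psiVec x y ^ 2 * (‖x‖ ^ 2 * ‖y‖ ^ 2) = ‖x‖ ^ 2 * ‖y‖ ^ 2 - inner ℝ x y ^ 2 := by
  have h := InnerProductGeometry.cos_angle_mul_norm_mul_norm x y
  have h2 := Real.sin_sq_add_cos_sq (InnerProductGeometry.angle x y)
  have h3 : psiVec x y ^ 2 = 1 - Real.cos (InnerProductGeometry.angle x y) ^ 2 := by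
    unfold psiVec; linarith
  rw [h3, ← h]
  ring

/-- If the pair of unit vectors `X`, `Y` minimizes `ψ` on `U × V`, then `X` is orthogonal to the
orthogonal complement of `Y` in `V`. -/
theorem inner_eq_zero_of_psiVec_minimal {n : ℕ} {V : Submodule ℝ (EucSp n)} {X Y : EucSp n}
    (hY : Y ∈ V) (hX1 : ‖X‖ = 1) (hY1 : ‖Y‖ = 1)
    (hmin : ∀ y ∈ V, y ≠ 0 → psiVec X Y ≤ psiVec X y) {y : EucSp n} (hy : y ∈ V)
    (hYy : inner ℝ Y y = 0) : inner ℝ X y = 0 := by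
  -- First variation: the squared cosine of the angle between `X` and `Y + t y` is at most its value
  -- at `t = 0`.
  have key : ∀ t : ℝ, (inner ℝ X Y + t * inner ℝ X y) ^ 2 ≤
      inner ℝ X Y ^ 2 * (1 + t ^ 2 * ‖y‖ ^ 2) := by
    intro t
    have hn : ‖Y + t • y‖ ^ 2 = 1 + t ^ 2 * ‖y‖ ^ 2 := by
      rw [norm_add_sq_real, inner_smul_right, hYy, norm_smul, hY1, mul_pow, Real.norm_eq_abs,
        sq_abs]
      ring
    have hn0 : Y + t • y ≠ 0 := by
      intro h
      rw [h, norm_zero] at hn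
      nlinarith [sq_nonneg (t * ‖y‖)]
    have h1 := hmin _ (V.add_mem hY (V.smul_mem t hy)) hn0
    have h2 := psiVec_sq_mul X (Y + t • y)
    have h3 := psiVec_sq_mul X Y
    have h4 : psiVec X Y ^ 2 ≤ psiVec X (Y + t • y) ^ 2 :=
      pow_le_pow_left₀ (psiVec_nonneg _ _) h1 2
    rw [hX1, hn, inner_add_right, inner_smul_right] at h2
    rw [hX1, hY1] at h3
    have h5 : 0 ≤ 1 + t ^ 2 * ‖y‖ ^ 2 := by positivity
    nlinarith [mul_le_mul_of_nonneg_right h4 h5]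
  by_contra hb
  set a := inner ℝ X Y
  set b := inner ℝ X y
  have ha : a ≠ 0 := by
    intro h
    have := key 1
    rw [h] at this
    have : 0 < b ^ 2 := by positivity
    nlinarith
  set s := a ^ 2 * ‖y‖ ^ 2 with hs
  have hs0 : 0 ≤ s := by positivity
  have hab : 0 < (a * b) ^ 2 := by positivity
  -- With this small `t`, the linear term `2tab` exceeds the quadratic term `t² s` on the right, so
  -- `ab ≠ 0` is impossible.
  have h := key (a * b / (s + 1))
  have h6 : 2 * (a * b) ^ 2 / (s + 1) + (a * b / (s + 1)) ^ 2 * b ^ 2 ≤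
      (a * b) ^ 2 / (s + 1) * (s / (s + 1)) := by
    have e1 : (a + a * b / (s + 1) * b) ^ 2 = a ^ 2 + 2 * (a * b) ^ 2 / (s + 1) +
        (a * b / (s + 1)) ^ 2 * b ^ 2 := by ring
    have e2 : a ^ 2 * (1 + (a * b / (s + 1)) ^ 2 * ‖y‖ ^ 2) = a ^ 2 +
      (a * b) ^ 2 / (s + 1) * (s / (s + 1)) := by rw [hs]; ring
    rw [e1, e2] at h
    linarith
  have h7 : s / (s + 1) ≤ 1 := by rw [div_le_one (by linarith)]; linarith
  have h8 : 0 < (a * b) ^ 2 / (s + 1) := by positivity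
  have h9 : 0 ≤ (a * b / (s + 1)) ^ 2 * b ^ 2 := by positivity
  have h10 : 2 * (a * b) ^ 2 / (s + 1) = 2 * ((a * b) ^ 2 / (s + 1)) := by ring
  nlinarith [mul_le_mul_of_nonneg_left h7 h8.le]

theorem remainder_anti {n : ℕ} (A : Submodule ℝ (EucSp n)) (X : ℕ → EucSp n) {i k : ℕ}
    (h : i ≤ k) : remainder A X k ≤ remainder A X i :=
  inf_le_inf_left A (Submodule.orthogonal_le (Submodule.span_mono
    (Set.image_mono (Set.Icc_subset_Icc_right h))))

theorem mem_remainder {n : ℕ} {A : Submodule ℝ (EucSp n)} {X : ℕ → EucSp n} {i : ℕ}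
    {y : EucSp n} : y ∈ remainder A X i ↔ y ∈ A ∧ ∀ k ∈ Set.Icc 1 i, inner ℝ (X k) y = 0 := by
  unfold remainder
  rw [Submodule.mem_inf, Submodule.mem_orthogonal]
  refine and_congr_right fun _ => ⟨fun h k hk => h _ (Submodule.subset_span ⟨k, hk, rfl⟩),
    fun h u hu => ?_⟩
  induction hu using Submodule.span_induction with
  | mem x hx => obtain ⟨k, hk, rfl⟩ := hx; exact h k hk
  | zero => simp
  | add x y _ _ hx hy => rw [inner_add_left, hx, hy, add_zero]
  | smul a x _ hx => rw [real_inner_smul_left, hx, mul_zero]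

/-- Each `Y k` is optimal for its own `X k`, so the first variation applies at every stage. Vectors
left in `C` are then orthogonal to the `X k` as well, and projecting them to `A` lands in the
remainder of `A`. -/
theorem IsCanonicalPairs.inner_eq_zero {n : ℕ} {A C : Submodule ℝ (EucSp n)} {j : ℕ}
    {X Y : ℕ → EucSp n} (h : IsCanonicalPairs A C j X Y) {i : ℕ} (hi : i ≤ j) {y : EucSp n}
    (hy : y ∈ remainder C Y i) : ∀ k ∈ Set.Icc 1 i, inner ℝ (X k) y = 0 := by
  rintro k ⟨hk1, hki⟩
  obtain ⟨k, rfl⟩ : ∃ k', k = k' + 1 := ⟨k - 1, by omega⟩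
  obtain ⟨hX, hY, hX1, hY1, hmin⟩ := h k (by omega)
  refine inner_eq_zero_of_psiVec_minimal hY hX1 hY1
    (fun y' hy' h0 => hmin _ hX y' hy' (norm_ne_zero_iff.1 (by rw [hX1]; exact one_ne_zero)) h0)
    (remainder_anti C Y (by omega) hy) ?_
  exact (mem_remainder.1 hy).2 _ ⟨hk1, hki⟩

/-- A subspace contains a nonzero vector orthogonal to any given subspace of smaller dimension. -/
theorem exists_mem_orthogonal_ne_zero {n : ℕ} (B S : Submodule ℝ (EucSp n))
    (h : Module.finrank ℝ S < Module.finrank ℝ B) : ∃ y ∈ B, y ∈ Sᗮ ∧ y ≠ 0 := by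
  have h0 : B ⊓ Sᗮ ≠ ⊥ := by
    intro h5
    have h2 := S.finrank_add_finrank_orthogonal
    have h3 := Submodule.finrank_sup_add_finrank_inf_eq B Sᗮ
    have h4 := Submodule.finrank_le (B ⊔ Sᗮ)
    rw [h5, finrank_bot] at h3
    omega
  obtain ⟨z, hz, hz0⟩ := Submodule.exists_mem_ne_zero_of_ne_bot h0
  exact ⟨z, hz.1, hz.2, hz0⟩

/-- If `C` contains a subspace of dimension `j` all of whose vectors are close to `A`, then
`ψ_j(A, C)` is small. -/
theorem psi_le {n j : ℕ} {A B C : Submodule ℝ (EucSp n)} {ε : ℝ} (hj : 1 ≤ j)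
    (hA : j ≤ Module.finrank ℝ A) (hB : Module.finrank ℝ B = j) (hBC : B ≤ C)
    (hε : ∀ y ∈ B, ‖y - A.starProjection y‖ ≤ ε * ‖y‖) : psi j A C ≤ ε := by
  obtain ⟨i, rfl⟩ : ∃ i, j = i + 1 := ⟨j - 1, by omega⟩
  obtain ⟨X, Y, hXY⟩ := exists_isCanonicalPairs A C (i + 1) hA
    (hB ▸ Submodule.finrank_mono hBC)
  refine (csInf_le ⟨0, ?_⟩ ⟨X, Y, hXY, rfl⟩ : psi (i + 1) A C ≤ _).trans ?_
  · rintro _ ⟨X, Y, -, rfl⟩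
    exact psiVec_nonneg _ _
  have hS : Module.finrank ℝ (Submodule.span ℝ (Y '' Set.Icc 1 i)) ≤ i := by
    have h := finrank_span_finset_le_card (R := ℝ) ((Finset.Icc 1 i).image Y)
    have h' := Finset.card_image_le (s := Finset.Icc 1 i) (f := Y)
    rw [Nat.card_Icc, Nat.add_sub_cancel] at h'
    rw [Finset.coe_image, Finset.coe_Icc] at h
    exact h.trans h'
  -- Only `j - 1` vectors `Y k` precede the last one, so the `j`-dimensional `B` still has a nonzero
  -- vector admissible at the last stage. It is paired with its projection to `A`.
  obtain ⟨y, hyB, hyS, hy0⟩ := exists_mem_orthogonal_ne_zero B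
    (Submodule.span ℝ (Y '' Set.Icc 1 i)) (by omega)
  have hyn : 0 < ‖y‖ := norm_pos_iff.2 hy0
  have hy : y ∈ remainder C Y i := ⟨hBC hyB, hyS⟩
  have hx := hXY.inner_eq_zero (Nat.le_succ i) hy
  have hXA : ∀ k ∈ Set.Icc 1 i, X k ∈ A := by
    rintro k ⟨hk1, hki⟩
    obtain ⟨k, rfl⟩ : ∃ k', k = k' + 1 := ⟨k - 1, by omega⟩
    exact (hXY k (by omega)).1.1
  obtain ⟨-, -, -, -, hmin⟩ := hXY i (Nat.lt_succ_self i)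
  by_cases hp : A.starProjection y = 0
  · have := hε y hyB
    rw [hp, sub_zero] at this
    have h1 : 1 ≤ ε := by nlinarith
    exact (Real.sin_le_one _).trans h1
  · have hpr : A.starProjection y ∈ remainder A X i := by
      refine mem_remainder.2 ⟨A.starProjection_apply_mem y, fun k hk => ?_⟩
      rw [← Submodule.inner_starProjection_left_eq_right,
        Submodule.starProjection_eq_self_iff.2 (hXA k hk)]
      exact hx k hk
    refine (hmin _ hpr y hy hp hy0).trans ?_
    set p := A.starProjection y with hpdef
    have hpn : 0 < ‖p‖ := norm_pos_iff.2 hp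
    have horth : inner ℝ p (y - p) = 0 := by
      rw [real_inner_comm]
      exact A.starProjection_inner_eq_zero y p (A.starProjection_apply_mem y)
    have hin : inner ℝ p y = ‖p‖ ^ 2 := by
      rw [inner_sub_right, real_inner_self_eq_norm_sq] at horth
      linarith
    have hpy : ‖y‖ ^ 2 = ‖p‖ ^ 2 + ‖y - p‖ ^ 2 := by
      have := norm_add_sq_real p (y - p)
      rw [horth, add_sub_cancel] at this
      linarith
    have h1 := psiVec_sq_mul p y
    rw [hin] at h1
    have h2 : (psiVec p y * ‖y‖) ^ 2 = ‖y - p‖ ^ 2 := by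
      have : ‖p‖ ^ 2 * ((psiVec p y * ‖y‖) ^ 2 - ‖y - p‖ ^ 2) = 0 := by
        have h3 : ‖y - p‖ ^ 2 = ‖y‖ ^ 2 - ‖p‖ ^ 2 := by linarith
        rw [h3]
        linarith
      rcases mul_eq_zero.1 this with h | h
      · exact absurd h (by positivity)
      · linarith
    have h3 : psiVec p y * ‖y‖ = ‖y - p‖ := by
      rwa [sq_eq_sq₀ (mul_nonneg (psiVec_nonneg _ _) hyn.le) (norm_nonneg _)] at h2
    have h4 := hε y hyB
    rw [← h3] at h4
    exact le_of_mul_le_mul_right h4 hyn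

/-- The relative distance to `A` of the vectors of `C` orthogonal to `A ∩ C` is bounded below. -/
theorem exists_pos_le_norm_sub_starProjection {n : ℕ} (A C : Submodule ℝ (EucSp n)) :
    ∃ κ : ℝ, 0 < κ ∧ ∀ y ∈ C, y ∈ (A ⊓ C)ᗮ → κ * ‖y‖ ≤ ‖y - A.starProjection y‖ := by
  set W : Submodule ℝ (EucSp n) := C ⊓ (A ⊓ C)ᗮ
  let f : W →ₗ[ℝ] EucSp n :=
    (LinearMap.id - (A.starProjection : EucSp n →ₗ[ℝ] EucSp n)) ∘ₗ W.subtype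
  -- A vector of the kernel lies in `A ∩ C` and is orthogonal to it. Injectivity in finite dimension
  -- then yields the lower bound.
  have hf : LinearMap.ker f = ⊥ := by
    rw [LinearMap.ker_eq_bot']
    rintro ⟨y, hyC, hyo⟩ hy
    have hy' : y - A.starProjection y = 0 := hy
    have hyA : y ∈ A := by
      rw [sub_eq_zero.1 hy']
      exact A.starProjection_apply_mem y
    have : inner ℝ y y = 0 := Submodule.inner_right_of_mem_orthogonal (K := A ⊓ C) ⟨hyA, hyC⟩ hyo
    exact Subtype.ext (inner_self_eq_zero.1 this)
  obtain ⟨K, hK0, hK⟩ := f.exists_antilipschitzWith hf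
  have hK0' : (0 : ℝ) < K := hK0
  refine ⟨(K : ℝ)⁻¹, by positivity, fun y hyC hyo => ?_⟩
  have h : ‖y‖ ≤ K * ‖y - A.starProjection y‖ :=
    hK.le_mul_norm (map_zero f) (⟨y, hyC, hyo⟩ : W)
  rw [inv_mul_le_iff₀ hK0']
  exact h

/-! ### Heights, Plücker coordinates and echelon bases. -/

theorem abs_le_height {n e : ℕ} {B : Submodule ℝ (EucSp n)} {Ξ : (Fin e ↪o Fin n) → ℤ}
    (h : IsPrimitivePlucker B Ξ) (I : Fin e ↪o Fin n) : |(Ξ I : ℝ)| ≤ height e B := by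
  rw [h.height_eq]
  exact Real.abs_le_sqrt (Finset.single_le_sum (f := fun J => (Ξ J : ℝ) ^ 2)
    (fun _ _ => sq_nonneg _) (Finset.mem_univ I))

theorem IsPrimitivePlucker.exists_ne_zero {n e : ℕ} {B : Submodule ℝ (EucSp n)}
    {Ξ : (Fin e ↪o Fin n) → ℤ} (h : IsPrimitivePlucker B Ξ) : ∃ I, Ξ I ≠ 0 := by
  by_contra! h0
  have := h.1
  rw [Finset.gcd_eq_zero_iff.2 fun I _ => h0 I] at this
  exact zero_ne_one this

theorem one_le_height {n e : ℕ} {B : Submodule ℝ (EucSp n)} (hB : B ∈ rationalSubspaces n e) :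
    1 ≤ height e B := by
  obtain ⟨Ξ, h⟩ := exists_isPrimitivePlucker hB
  obtain ⟨I, hI⟩ := h.exists_ne_zero
  refine le_trans ?_ (abs_le_height h I)
  exact_mod_cast Int.one_le_abs hI

theorem sqrt_sum_sq_le {ι : Type*} [Fintype ι] (f : ι → ℝ) {M : ℝ} (h : ∀ i, |f i| ≤ M) :
    √(∑ i, f i ^ 2) ≤ Fintype.card ι * M := by
  rcases isEmpty_or_nonempty ι with hι | ⟨⟨i₀⟩⟩
  · simp
  have hM : 0 ≤ M := (abs_nonneg _).trans (h i₀)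
  have h1 : (1 : ℝ) ≤ Fintype.card ι := by
    exact_mod_cast Fintype.card_pos_iff.2 ⟨i₀⟩
  rw [Real.sqrt_le_iff]
  refine ⟨by positivity, ?_⟩
  calc ∑ i, f i ^ 2 ≤ ∑ _i : ι, M ^ 2 := Finset.sum_le_sum fun i _ => by
        rw [← sq_abs]; exact pow_le_pow_left₀ (abs_nonneg _) (h i) 2
    _ = Fintype.card ι * M ^ 2 := by simp
    _ ≤ (Fintype.card ι * M) ^ 2 := by
        rw [mul_pow]
        exact mul_le_mul_of_nonneg_right (by nlinarith) (sq_nonneg M)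

/-- Any nonzero integer vector of Plücker coordinates bounds the height. -/
theorem height_le {n e : ℕ} {B : Submodule ℝ (EucSp n)} (b : Module.Basis (Fin e) ℝ B)
    (z : (Fin e ↪o Fin n) → ℤ) {c M : ℝ} (hc : c ≠ 0)
    (hz : ∀ I, (z I : ℝ) = c * pluckerCoord (fun k => (b k : EucSp n)) I)
    (hM : ∀ I, |c * pluckerCoord (fun k => (b k : EucSp n)) I| ≤ M) :
    height e B ≤ Fintype.card (Fin e ↪o Fin n) * M := by
  obtain ⟨I, hI⟩ := exists_pluckerCoord_ne_zero b
  have hzI : z I ≠ 0 := fun h => by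
    have := hz I
    rw [h] at this
    simp [hI, hc] at this
  -- Dividing by the gcd makes the vector primitive and can only shrink its coordinates.
  obtain ⟨Ξ, h1, h2⟩ := Finset.extract_gcd z ⟨I, Finset.mem_univ I⟩
  set g := Finset.univ.gcd z
  have hg : g ≠ 0 := fun h => hzI (by rw [h1 I (Finset.mem_univ I), h, zero_mul])
  have hg' : (g : ℝ) ≠ 0 := by exact_mod_cast hg
  have hg1 : (1 : ℝ) ≤ |(g : ℝ)| := by exact_mod_cast Int.one_le_abs hg
  have h3 : ∀ J, (z J : ℝ) = (g : ℝ) * Ξ J := fun J => by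
    exact_mod_cast h1 J (Finset.mem_univ J)
  have hp : IsPrimitivePlucker B Ξ := by
    refine ⟨h2, b, c / g, div_ne_zero hc hg', fun J => ?_⟩
    have := h3 J
    rw [hz] at this
    rw [div_mul_eq_mul_div, this, mul_div_cancel_left₀ _ hg']
  rw [hp.height_eq]
  refine sqrt_sum_sq_le _ fun J => le_trans ?_ (hM J)
  rw [← hz, h3, abs_mul]
  exact le_mul_of_one_le_left (abs_nonneg _) hg1

theorem apply_sum_smul {n : ℕ} {ι : Type*} [Fintype ι] (a : ι → ℝ) (y : ι → EucSp n) (i : Fin n) :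
    (∑ k, a k • y k) i = ∑ k, a k * y k i := by
  simp

theorem linearIndependent_of_apply_eq {n m : ℕ} {y : Fin m → EucSp n} {I : Fin m → Fin n}
    {q : ℝ} (hq : q ≠ 0) (hy : ∀ k l, y k (I l) = if k = l then q else 0) :
    LinearIndependent ℝ y := by
  rw [Fintype.linearIndependent_iff]
  intro g hg l
  have := congrArg (fun v : EucSp n => v (I l)) hg
  simp only [apply_sum_smul, hy] at this
  simpa [hq] using this

/-- A basis which is the identity matrix on the coordinates of a nonzero minor. -/
theorem exists_echelon_basis {n e : ℕ} {B : Submodule ℝ (EucSp n)} (b : Module.Basis (Fin e) ℝ B)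
    {I : Fin e ↪o Fin n} (hI : pluckerCoord (fun k => (b k : EucSp n)) I ≠ 0) :
    ∃ y : Module.Basis (Fin e) ℝ B, ∀ k l, (y k : EucSp n) (I l) = if k = l then 1 else 0 := by
  set M : Matrix (Fin e) (Fin e) ℝ := Matrix.of fun k l => (b k : EucSp n) (I l) with hM
  have hdet : IsUnit M.det := isUnit_iff_ne_zero.2 hI
  let v : Fin e → B := fun k => ∑ m, M⁻¹ k m • b m
  have hv : ∀ k l, (v k : EucSp n) (I l) = if k = l then 1 else 0 := by
    intro k l
    have h := congrFun (congrFun (Matrix.nonsing_inv_mul M hdet) k) l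
    rw [Matrix.mul_apply, Matrix.one_apply] at h
    simp only [v, Submodule.coe_sum, Submodule.coe_smul, apply_sum_smul]
    exact h
  have hli : LinearIndependent ℝ v := by
    have := linearIndependent_of_apply_eq (y := fun k => (v k : EucSp n)) one_ne_zero hv
    exact LinearIndependent.of_comp B.subtype this
  have hcard : Fintype.card (Fin e) = Module.finrank ℝ B := by
    rw [Module.finrank_eq_card_basis b]
  refine ⟨Module.Basis.mk hli (hli.span_eq_top_of_card_eq_finrank' hcard).ge, fun k l => ?_⟩
  rw [Module.Basis.mk_apply]
  exact hv k l

/-- Expansion of the Plücker coordinates along the first vector. -/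
theorem pluckerCoord_cons {n m : ℕ} (v : EucSp n) (b : Fin m → EucSp n)
    (J : Fin (m + 1) ↪o Fin n) : pluckerCoord (Fin.cons v b : Fin (m + 1) → EucSp n) J =
      ∑ s : Fin (m + 1), (-1) ^ (s : ℕ) * v (J s) *
        pluckerCoord b ((Fin.succAboveOrderEmb s).trans J) := by
  unfold pluckerCoord
  rw [Matrix.det_succ_row_zero]
  rfl

theorem mem_rationalSubspaces_finrank {n e : ℕ} {B : Submodule ℝ (EucSp n)}
    (hB : B ∈ rationalSubspaces n e) : Module.finrank ℝ B = e := by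
  obtain ⟨b, -⟩ := hB
  simpa using Module.finrank_eq_card_basis b

/-! ### Integer points close to a rational subspace. -/

/-- Two elements of a large set have nearly the same image in the torus. -/
theorem exists_ne_abs_sub_sub_le {α ι : Type*} [Fintype ι] {K : ℕ} (hK : 0 < K) (g : α → ι → ℝ)
    (h : Infinite α ∨ K ^ Fintype.card ι < Nat.card α) :
    ∃ x x', x ≠ x' ∧ ∀ i, ∃ z : ℤ, |g x i - g x' i - z| ≤ 1 / K := by
  classical
  have hK' : (0 : ℝ) < K := by exact_mod_cast hK
  have hlt : ∀ x i, ⌊K * Int.fract (g x i)⌋₊ < K := fun x i => by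
    rw [Nat.floor_lt (by have := Int.fract_nonneg (g x i); positivity)]
    exact mul_lt_of_lt_one_right hK' (Int.fract_lt_one _)
  -- Pigeonhole on the cubes of side `1/K` that partition the torus.
  let f : α → ι → Fin K := fun x i => ⟨_, hlt x i⟩
  obtain ⟨x, x', hne, hf⟩ : ∃ x x', x ≠ x' ∧ f x = f x' := by
    rcases h with h | h
    · exact Finite.exists_ne_map_eq_of_infinite f
    · have := Nat.finite_of_card_ne_zero (α := α) (by omega)
      have := Fintype.ofFinite α
      refine Fintype.exists_ne_map_eq_of_card_lt f ?_
      rw [Fintype.card_fun, Fintype.card_fin, ← Nat.card_eq_fintype_card (α := α)]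
      exact h
  refine ⟨x, x', hne, fun i => ⟨⌊g x i⌋ - ⌊g x' i⌋, ?_⟩⟩
  have h1 : ⌊K * Int.fract (g x i)⌋₊ = ⌊K * Int.fract (g x' i)⌋₊ :=
    congrArg Fin.val (congrFun hf i)
  have hp : ∀ y, 0 ≤ K * Int.fract (g y i) := fun y => by
    have := Int.fract_nonneg (g y i); positivity
  have a1 := Nat.floor_le (hp x)
  have a2 := Nat.lt_floor_add_one (K * Int.fract (g x i))
  have b1 := Nat.floor_le (hp x')
  have b2 := Nat.lt_floor_add_one (K * Int.fract (g x' i))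
  rw [h1] at a1 a2
  have e : g x i - g x' i - ((⌊g x i⌋ - ⌊g x' i⌋ : ℤ) : ℝ) =
      (K * Int.fract (g x i) - K * Int.fract (g x' i)) / K := by
    rw [← mul_sub, mul_div_cancel_left₀ _ hK'.ne', ← Int.self_sub_floor, ← Int.self_sub_floor]
    push_cast
    ring
  rw [e, abs_div, abs_of_pos hK']
  gcongr
  rw [abs_le]
  constructor <;> linarith

theorem eq_sum_of_echelon {n m : ℕ} {B : Submodule ℝ (EucSp n)} (y : Module.Basis (Fin m) ℝ B)
    {I : Fin m → Fin n} (hy : ∀ k l, (y k : EucSp n) (I l) = if k = l then 1 else 0)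
    {x : EucSp n} (hx : x ∈ B) : x = ∑ k, x (I k) • (y k : EucSp n) := by
  have h := congrArg (Subtype.val) (y.sum_repr ⟨x, hx⟩)
  simp only [Submodule.coe_sum, Submodule.coe_smul] at h
  have h2 : ∀ l, x (I l) = y.repr ⟨x, hx⟩ l := fun l => by
    have h3 := congrArg (fun v : EucSp n => v (I l)) h
    simp only [apply_sum_smul, hy] at h3
    simpa using h3.symm
  simp only [h2]
  exact h.symm

theorem IsPrimitivePlucker.exists_mul_pluckerCoord {n e : ℕ} {B : Submodule ℝ (EucSp n)}
    {Ξ : (Fin e ↪o Fin n) → ℤ} (h : IsPrimitivePlucker B Ξ) (b : Module.Basis (Fin e) ℝ B) :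
    ∃ c : ℝ, c ≠ 0 ∧ ∀ I, (Ξ I : ℝ) = c * pluckerCoord (fun k => (b k : EucSp n)) I := by
  obtain ⟨I, hI⟩ := h.exists_ne_zero
  obtain ⟨-, b', c, hc, hb'⟩ := h
  have h1 : ∀ I, (Ξ I : ℝ) = (c * (b.toMatrix b').det) *
      pluckerCoord (fun k => (b k : EucSp n)) I := fun I => by
    rw [hb', pluckerCoord_basis b b', mul_assoc]
  refine ⟨_, fun h0 => hI ?_, h1⟩
  have := h1 I
  rw [h0, zero_mul] at this
  exact_mod_cast this

/-- The integer combinations of the vectors `y` having integer coordinates. -/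
def integralCombinations {n m : ℕ} (y : Fin m → EucSp n) : AddSubgroup (Fin m → ℤ) where
  carrier := {u | ∀ i, ∃ z : ℤ, ∑ k, (u k : ℝ) * y k i = z}
  zero_mem' i := ⟨0, by simp⟩
  add_mem' {u v} hu hv i := by
    obtain ⟨a, ha⟩ := hu i
    obtain ⟨b, hb⟩ := hv i
    exact ⟨a + b, by simp [add_mul, Finset.sum_add_distrib, ha, hb]⟩
  neg_mem' {u} hu i := by
    obtain ⟨a, ha⟩ := hu i
    exact ⟨-a, by simp [ha]⟩

/-- The points of `ℤⁿ` in a rational subspace project to a lattice of large index. -/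
theorem index_integralCombinations {n m : ℕ} {B : Submodule ℝ (EucSp n)}
    {Ξ : (Fin m ↪o Fin n) → ℤ} (h : IsPrimitivePlucker B Ξ) (y : Module.Basis (Fin m) ℝ B)
    {I : Fin m ↪o Fin n} (hy : ∀ k l, (y k : EucSp n) (I l) = if k = l then 1 else 0)
    (h0 : (integralCombinations fun k => (y k : EucSp n)).index ≠ 0) :
    (Ξ I).natAbs ≤ (integralCombinations fun k => (y k : EucSp n)).index := by
  set Λ := integralCombinations fun k => (y k : EucSp n) with hΛ
  obtain ⟨f⟩ := Int.addSubgroup_index_ne_zero_iff.1 h0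
  let bN : Module.Basis (Fin m) ℤ Λ := Module.Basis.ofEquivFun f.toIntLinearEquiv
  have hidx := AddSubgroup.index_eq_natAbs_det (Pi.basisFun ℤ (Fin m)) Λ bN
  set U : Matrix (Fin m) (Fin m) ℤ := Matrix.of fun i k => (bN i : Fin m → ℤ) k with hU
  have hdet : (Pi.basisFun ℤ (Fin m)).det (fun x => (bN x : Fin m → ℤ)) = U.det := by
    rw [Module.Basis.det_apply, ← Matrix.det_transpose]
    congr 1
  rw [hdet] at hidx
  have hz : ∀ i l, ∃ z : ℤ, ∑ k, (U i k : ℝ) * (y k : EucSp n) l = z := fun i l => (bN i).2 l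
  choose Z hZ using hz
  obtain ⟨c, hc, hΞ⟩ := h.exists_mul_pluckerCoord y
  have hyI : pluckerCoord (fun k => (y k : EucSp n)) I = 1 := by
    unfold pluckerCoord
    rw [← Matrix.det_one (n := Fin m)]
    congr 1
    ext k l
    simp [hy, Matrix.one_apply]
  have hcI : (Ξ I : ℝ) = c := by rw [hΞ, hyI, mul_one]
  -- A basis of the lattice gives integer vectors of `B` whose minors are `det U` times those of
  -- `y`, and the latter are `Ξ J / Ξ I`. Since the `Ξ J` are coprime, Bézout forces `Ξ I ∣ det U`.
  have hW : ∀ J : Fin m ↪o Fin n, U.det * Ξ J =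
      Ξ I * Matrix.det (Matrix.of fun i l => Z i (J l)) := by
    intro J
    have h1 : ((Matrix.det (Matrix.of fun i l => Z i (J l)) : ℤ) : ℝ) =
        (U.det : ℝ) * pluckerCoord (fun k => (y k : EucSp n)) J := by
      have e1 : ((Matrix.det (Matrix.of fun i l => Z i (J l)) : ℤ) : ℝ) =
          ((Matrix.of fun i l => Z i (J l)).map (Int.castRingHom ℝ)).det :=
        (Int.castRingHom ℝ).map_det _
      have e2 : (U.det : ℝ) = (U.map (Int.castRingHom ℝ)).det := (Int.castRingHom ℝ).map_det _
      rw [e1, e2, pluckerCoord, ← Matrix.det_mul]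
      congr 1
      ext i l
      simp [Matrix.mul_apply, ← hZ]
    have h2 : (U.det : ℝ) * Ξ J =
        Ξ I * ((Matrix.det (Matrix.of fun i l => Z i (J l)) : ℤ) : ℝ) := by
      rw [h1, hΞ J, hcI]
      ring
    exact_mod_cast h2
  obtain ⟨t, ht⟩ := Finset.gcd_eq_sum_mul Finset.univ Ξ
  rw [h.1] at ht
  have hdvd : Ξ I ∣ U.det := by
    have : U.det = ∑ J, U.det * Ξ J * t J := by
      simp only [mul_assoc, ← Finset.mul_sum]
      rw [← ht, mul_one]
    rw [this]
    exact Finset.dvd_sum fun J _ => by rw [hW, mul_assoc]; exact Dvd.intro _ rfl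
  rw [hidx] at h0 ⊢
  exact Nat.le_of_dvd (Nat.pos_of_ne_zero h0) (Int.natAbs_dvd_natAbs.2 hdvd)

theorem card_subtype_notMem_range {n m : ℕ} (I : Fin m ↪o Fin n) :
    Nat.card {i : Fin n // i ∉ Set.range I} = n - m := by
  classical
  have : Fintype.card {i : Fin n // i ∈ Set.range I} = m := by
    rw [← Nat.card_eq_fintype_card]
    exact (Nat.card_range_of_injective I.injective).trans (by simp)
  rw [Nat.card_eq_fintype_card, Fintype.card_subtype_compl, this, Fintype.card_fin]

/-- An integer point outside a rational subspace `B` and close to it. -/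
theorem exists_int_close {n m : ℕ} (hm : m < n) {B : Submodule ℝ (EucSp n)}
    {Ξ : (Fin m ↪o Fin n) → ℤ} (h : IsPrimitivePlucker B Ξ) {I : Fin m ↪o Fin n} (hI : Ξ I ≠ 0) :
    ∃ (z : Fin n → ℤ) (w : EucSp n) (δ : ℝ), WithLp.toLp 2 (fun i => (z i : ℝ)) ∉ B ∧
      WithLp.toLp 2 (fun i => (z i : ℝ)) - w ∈ B ∧ (∀ i, |w i| ≤ δ) ∧ 0 < δ ∧
      δ ^ (n - m) * |(Ξ I : ℝ)| ≤ 2 ^ (n - m) := by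
  classical
  obtain ⟨-, b, c, hc, hb⟩ := id h
  have hbI : pluckerCoord (fun k => (b k : EucSp n)) I ≠ 0 := fun h0 => hI (by
    have := hb I
    rw [h0, mul_zero] at this
    exact_mod_cast this)
  obtain ⟨y, hy⟩ := exists_echelon_basis b hbI
  have hvan : ∀ x ∈ B, (∀ l, x (I l) = 0) → x = 0 := fun x hx h0 => by
    rw [eq_sum_of_echelon y hy hx]
    simp [h0]
  have hcard := card_subtype_notMem_range I
  set r := n - m with hr
  set D := (Ξ I).natAbs with hD
  have hDabs : |(Ξ I : ℝ)| = D := by rw [hD, Nat.cast_natAbs, Int.cast_abs]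
  have hD1 : 1 ≤ D := Int.natAbs_pos.2 hI
  have hr0 : r ≠ 0 := by omega
  have hex : ∃ K : ℕ, D ≤ (K + 1) ^ r := ⟨D, (Nat.le_succ D).trans (Nat.le_self_pow hr0 _)⟩
  -- `K` is the largest integer with `K^r < D`, so that there are fewer cubes than classes modulo
  -- the lattice; `K = 0` happens only for `D = 1`, where a coordinate vector outside `I` suffices.
  obtain ⟨K, hKD, hKmin⟩ : ∃ K : ℕ, D ≤ (K + 1) ^ r ∧ (K = 0 ∨ K ^ r < D) := by
    refine ⟨Nat.find hex, Nat.find_spec hex, ?_⟩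
    rcases Nat.eq_zero_or_pos (Nat.find hex) with h0 | h0
    · exact Or.inl h0
    · right
      have := Nat.find_min hex (m := Nat.find hex - 1) (by omega)
      rw [Nat.sub_add_cancel h0] at this
      omega
  rw [hDabs]
  rcases Nat.eq_zero_or_pos K with hK | hK
  · subst hK
    obtain ⟨⟨i, hi⟩⟩ : Nonempty {i : Fin n // i ∉ Set.range I} :=
      (Nat.card_pos_iff.1 (by omega)).1
    refine ⟨Pi.single i 1, WithLp.toLp 2 (fun k => ((Pi.single i 1 : Fin n → ℤ) k : ℝ)), 1,
      fun hB => ?_, ?_, fun k => ?_, one_pos, ?_⟩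
    · have := hvan _ hB fun l => by
        have : I l ≠ i := fun h => hi ⟨l, h⟩
        simp [this]
      have := congrArg (fun v : EucSp n => v i) this
      simp at this
    · simp
    · rcases eq_or_ne k i with rfl | hk
      · simp
      · simp [hk]
    · have : D = 1 := by
        rw [zero_add, one_pow] at hKD
        omega
      rw [this, one_pow, Nat.cast_one, one_mul]
      exact one_le_pow₀ one_le_two
  · replace hKmin : K ^ r < D := hKmin.resolve_left hK.ne'
    set Λ := integralCombinations fun k => (y k : EucSp n) with hΛ
    have hbig : Infinite ((Fin m → ℤ) ⧸ Λ) ∨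
        K ^ Fintype.card {i : Fin n // i ∉ Set.range I} < Nat.card ((Fin m → ℤ) ⧸ Λ) := by
      rw [← Nat.card_eq_fintype_card, hcard]
      -- Index `0` encodes infinite index, for which the pigeonhole is immediate.
      by_cases h0 : Λ.index = 0
      · left
        by_contra hfin
        rw [not_infinite_iff_finite] at hfin
        exact Nat.card_pos.ne' (h0 : Nat.card ((Fin m → ℤ) ⧸ Λ) = 0)
      · right
        exact hKmin.trans_le (index_integralCombinations h y hy h0)
    obtain ⟨x, x', hne, hxx⟩ := exists_ne_abs_sub_sub_le hK
      (fun (x : (Fin m → ℤ) ⧸ Λ) (i : {i : Fin n // i ∉ Set.range I}) =>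
        ∑ k, (x.out k : ℝ) * (y k : EucSp n) i) hbig
    set u : Fin m → ℤ := x.out - x'.out with hu
    have huΛ : u ∉ Λ := fun hmem => hne (by
      rw [← x.out_eq', ← x'.out_eq']
      refine (QuotientAddGroup.eq.2 ?_).symm
      rwa [neg_add_eq_sub])
    set s : EucSp n := ∑ k, (u k : ℝ) • (y k : EucSp n) with hs
    have hsi : ∀ i, s i = ∑ k, (u k : ℝ) * (y k : EucSp n) i := fun i => apply_sum_smul _ _ i
    -- The point `s` of `B` above `u` is exactly integral on the coordinates in `I` and nearly so
    -- elsewhere. If its rounding `z` were in `B`, it would equal `s`, contradicting `u ∉ Λ`.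
    have hz : ∀ i, ∃ z : ℤ, |s i - z| ≤ 1 / K ∧ (i ∈ Set.range I → s i = z) := by
      intro i
      by_cases hi : i ∈ Set.range I
      · obtain ⟨l, rfl⟩ := hi
        have : s (I l) = u l := by rw [hsi]; simp [hy]
        exact ⟨u l, by rw [this]; simp, fun _ => this⟩
      · obtain ⟨z, hz⟩ := hxx ⟨i, hi⟩
        refine ⟨z, ?_, fun h => absurd h hi⟩
        convert hz using 3
        rw [hsi, ← Finset.sum_sub_distrib]
        exact Finset.sum_congr rfl fun k _ => by simp [hu, sub_mul]
    choose z hz1 hz2 using hz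
    have hsB : s ∈ B := B.sum_mem fun k _ => B.smul_mem _ (y k).2
    have hK' : (0 : ℝ) < K := by exact_mod_cast hK
    refine ⟨z, WithLp.toLp 2 (fun i => (z i : ℝ)) - s, 1 / K, fun hB => huΛ fun i => ⟨z i, ?_⟩,
      ?_, fun i => ?_, by positivity, ?_⟩
    · have := hvan _ (B.sub_mem hB hsB) fun l => by simp [hz2 (I l) ⟨l, rfl⟩]
      rw [← hsi]
      have := congrArg (fun v : EucSp n => v i) this
      simp only [PiLp.sub_apply, PiLp.zero_apply] at this
      linarith
    · rwa [sub_sub_cancel]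
    · rw [PiLp.sub_apply, abs_sub_comm]
      exact hz1 i
    · have h1 : (D : ℝ) ≤ (2 * K) ^ r := by
        have : D ≤ (2 * K) ^ r := hKD.trans (Nat.pow_le_pow_left (by omega) r)
        exact_mod_cast this
      rw [one_div, inv_pow, inv_mul_le_iff₀ (by positivity), ← mul_pow, mul_comm (K : ℝ)]
      exact h1

/-! ### Going up in dimension. -/

theorem pluckerCoord_cons_add {n m : ℕ} (v w : EucSp n) (b : Fin m → EucSp n)
    (J : Fin (m + 1) ↪o Fin n) : pluckerCoord (Fin.cons (v + w) b : Fin (m + 1) → EucSp n) J =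
      pluckerCoord (Fin.cons v b : Fin (m + 1) → EucSp n) J +
      pluckerCoord (Fin.cons w b : Fin (m + 1) → EucSp n) J := by
  simp only [pluckerCoord_cons, ← Finset.sum_add_distrib, PiLp.add_apply]
  exact Finset.sum_congr rfl fun _ _ => by ring

theorem pluckerCoord_cons_eq_zero {n m : ℕ} {B : Submodule ℝ (EucSp n)}
    (b : Module.Basis (Fin m) ℝ B) {x : EucSp n} (hx : x ∈ B) (J : Fin (m + 1) ↪o Fin n) :
    pluckerCoord (Fin.cons x (fun k => (b k : EucSp n)) : Fin (m + 1) → EucSp n) J = 0 := by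
  unfold pluckerCoord
  by_contra h
  have h1 := Matrix.linearIndependent_rows_iff_isUnit.2
    ((Matrix.isUnit_iff_isUnit_det _).2 (isUnit_iff_ne_zero.2 h))
  let f : EucSp n →ₗ[ℝ] (Fin (m + 1) → ℝ) :=
    LinearMap.pi fun l => (EuclideanSpace.proj (J l) : EucSp n →L[ℝ] ℝ).toLinearMap
  have h2 : LinearIndependent ℝ (Fin.cons x (fun k => (b k : EucSp n)) : Fin (m + 1) → EucSp n) :=
    LinearIndependent.of_comp f h1
  rw [linearIndependent_finCons] at h2
  refine h2.2 ?_
  have := b.mem_span ⟨x, hx⟩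
  have h3 := Submodule.mem_map_of_mem (f := B.subtype) this
  rw [Submodule.map_span, ← Set.range_comp] at h3
  exact h3

/-- Going up: a rational subspace is contained in a rational subspace of the next dimension of
controlled height. -/
theorem exists_rational_succ {n m : ℕ} (hm : m < n) : ∃ κ : ℝ, 1 ≤ κ ∧
    ∀ B ∈ rationalSubspaces n m, ∃ C ∈ rationalSubspaces n (m + 1), B ≤ C ∧
      height (m + 1) C ^ (n - m) ≤ κ * height m B ^ (n - (m + 1)) := by
  set N : ℝ := (Fintype.card (Fin (m + 1) ↪o Fin n) : ℝ) with hN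
  refine ⟨max 1 ((N * (m + 1) * 2) ^ (n - m)), le_max_left _ _, fun B hB => ?_⟩
  obtain ⟨Ξ, h⟩ := exists_isPrimitivePlucker hB
  obtain ⟨I₀, hI₀⟩ := h.exists_ne_zero
  obtain ⟨I, -, hmax⟩ := Finset.exists_max_image Finset.univ (fun J => |(Ξ J : ℝ)|)
    ⟨I₀, Finset.mem_univ _⟩
  have hI : Ξ I ≠ 0 := fun h0 => hI₀ (by
    have := hmax I₀ (Finset.mem_univ _)
    simpa [h0] using this)
  obtain ⟨z, w, δ, hzB, hzw, hw, hδ, hδD⟩ := exists_int_close hm h hI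
  set v : EucSp n := WithLp.toLp 2 (fun i => (z i : ℝ)) with hv
  set D := |(Ξ I : ℝ)| with hD
  obtain ⟨b, hb⟩ := hB
  obtain ⟨c, hc, hΞ⟩ := h.exists_mul_pluckerCoord b
  set β : Fin m → EucSp n := fun k => (b k : EucSp n) with hβ
  have hspan : ∀ x, x ∈ Submodule.span ℝ (Set.range β) ↔ x ∈ B := by
    have h3 := congrArg (Submodule.map B.subtype) b.span_eq
    rw [Submodule.map_span, ← Set.range_comp, Submodule.map_top, Submodule.range_subtype] at h3
    intro x
    rw [← h3]
    rfl
  have hli : LinearIndependent ℝ (Fin.cons v β : Fin (m + 1) → EucSp n) := by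
    rw [linearIndependent_finCons]
    exact ⟨b.linearIndependent.map' B.subtype (Submodule.ker_subtype B),
      fun hmem => hzB ((hspan v).1 hmem)⟩
  let b' := Module.Basis.span hli
  have hb' : (fun k => (b' k : EucSp n)) = Fin.cons v β := by
    funext k
    exact congrArg Subtype.val (Module.Basis.span_apply hli k)
  -- Modulo `B` the integer vector `v` is the short vector `w`: integrality of the minors is read on
  -- `v`, their size on `w`.
  have hP : ∀ J, pluckerCoord (Fin.cons v β : Fin (m + 1) → EucSp n) J =
      pluckerCoord (Fin.cons w β : Fin (m + 1) → EucSp n) J := fun J => by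
    conv_lhs => rw [← sub_add_cancel v w]
    rw [pluckerCoord_cons_add, pluckerCoord_cons_eq_zero b hzw, zero_add]
  refine ⟨Submodule.span ℝ (Set.range (Fin.cons v β : Fin (m + 1) → EucSp n)),
    ⟨b', fun k i => ?_⟩, fun x hx => ?_, ?_⟩
  · rw [congrFun hb' k]
    refine Fin.cases ?_ (fun k => ?_) k
    · exact ⟨z i, by simp [hv]⟩
    · exact hb k i
  · refine Submodule.span_mono ?_ ((hspan x).2 hx)
    rintro _ ⟨k, rfl⟩
    exact ⟨k.succ, rfl⟩
  · have hH := height_le b' (fun J => ∑ s : Fin (m + 1), (-1) ^ (s : ℕ) * z (J s) *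
        Ξ ((Fin.succAboveOrderEmb s).trans J)) (c := c) (M := (m + 1) * (δ * D)) hc
      (fun J => by
        rw [hb', pluckerCoord_cons, Finset.mul_sum]
        push_cast
        refine Finset.sum_congr rfl fun s _ => ?_
        rw [hΞ]
        simp only [hv]
        ring)
      (fun J => by
        rw [hb', hP, pluckerCoord_cons, Finset.mul_sum]
        refine (Finset.abs_sum_le_sum_abs _ _).trans ?_
        have : ((m : ℝ) + 1) * (δ * D) = ∑ _s : Fin (m + 1), δ * D := by simp
        rw [this]
        refine Finset.sum_le_sum fun s _ => ?_
        have e : c * ((-1) ^ (s : ℕ) * w (J s) *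
            pluckerCoord β ((Fin.succAboveOrderEmb s).trans J)) =
            (-1) ^ (s : ℕ) * w (J s) * Ξ ((Fin.succAboveOrderEmb s).trans J) := by
          rw [hΞ]; ring
        rw [e, abs_mul, abs_mul, abs_pow, abs_neg, abs_one, one_pow, one_mul]
        exact mul_le_mul (hw _) (hmax _ (Finset.mem_univ _)) (abs_nonneg _) hδ.le)
    rw [← hN] at hH
    have hD0 : 0 ≤ D := abs_nonneg _
    have hDH : D ≤ height m B := abs_le_height h I
    have hN0 : 0 ≤ N := Nat.cast_nonneg _
    have hr : n - m = (n - (m + 1)) + 1 := by omega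
    -- One factor `D` of `D^{n-m}` is cancelled by `δ^{n-m} D ≤ 2^{n-m}`, which lowers the exponent
    -- of the height by one.
    calc height (m + 1) _ ^ (n - m) ≤ (N * ((m + 1) * (δ * D))) ^ (n - m) :=
          pow_le_pow_left₀ (Real.sInf_nonneg (by rintro _ ⟨_, _, rfl⟩; positivity)) hH _
      _ = (N * (m + 1)) ^ (n - m) * (δ ^ (n - m) * D) * D ^ (n - (m + 1)) := by
          have : D ^ (n - m) = D * D ^ (n - (m + 1)) := by rw [hr, pow_succ']
          rw [mul_assoc _ _ (D ^ _), mul_assoc, ← this, ← mul_pow, ← mul_pow]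
          ring
      _ ≤ (N * (m + 1)) ^ (n - m) * 2 ^ (n - m) * height m B ^ (n - (m + 1)) := by
          gcongr
      _ ≤ _ := by
          rw [← mul_pow]
          have : 0 ≤ height m B := hD0.trans hDH
          gcongr
          exact le_max_right _ _

/-- Iterated going up. -/
theorem exists_rational_of_le {n j e : ℕ} (hje : j ≤ e) (hen : e ≤ n) : ∃ κ : ℝ, 1 ≤ κ ∧
    ∀ B ∈ rationalSubspaces n j, ∃ C ∈ rationalSubspaces n e, B ≤ C ∧
      height e C ^ (n - j) ≤ κ * height j B ^ (n - e) := by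
  induction e, hje using Nat.le_induction with
  | base => exact ⟨1, le_rfl, fun B hB => ⟨B, hB, le_rfl, by rw [one_mul]⟩⟩
  | succ m hm ih =>
    obtain ⟨κ, hκ, h⟩ := ih (by omega)
    obtain ⟨κ', hκ', h'⟩ := exists_rational_succ (n := n) (m := m) (by omega)
    refine ⟨κ' ^ (n - j) * κ ^ (n - (m + 1)), one_le_mul_of_one_le_of_one_le (one_le_pow₀ hκ')
      (one_le_pow₀ hκ), fun B hB => ?_⟩
    obtain ⟨C, hC, hBC, hCH⟩ := h B hB
    obtain ⟨C', hC', hCC', hCH'⟩ := h' C hC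
    refine ⟨C', hC', hBC.trans hCC', ?_⟩
    have h0 : 0 ≤ height j B := zero_le_one.trans (one_le_height hB)
    have h1 : 0 ≤ height m C := zero_le_one.trans (one_le_height hC)
    have h2 : 0 ≤ height (m + 1) C' := zero_le_one.trans (one_le_height hC')
    have hnm : n - m ≠ 0 := by omega
    have hK1 : 1 ≤ κ' ^ (n - j) * κ ^ (n - (m + 1)) :=
      one_le_mul_of_one_le_of_one_le (one_le_pow₀ hκ') (one_le_pow₀ hκ)
    have hκ0 : 0 ≤ κ := by linarith
    have hκ0' : 0 ≤ κ' := by linarith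
    -- The exponents telescope: after raising to the power `n - m`, the intermediate height `H(C)`
    -- is eliminated.
    refine le_of_pow_le_pow_left₀ hnm (by positivity) ?_
    calc (height (m + 1) C' ^ (n - j)) ^ (n - m) = (height (m + 1) C' ^ (n - m)) ^ (n - j) := by
          rw [← pow_mul, ← pow_mul, mul_comm]
      _ ≤ (κ' * height m C ^ (n - (m + 1))) ^ (n - j) := by gcongr
      _ = κ' ^ (n - j) * (height m C ^ (n - j)) ^ (n - (m + 1)) := by
          rw [mul_pow, ← pow_mul, ← pow_mul, mul_comm (n - (m + 1))]
      _ ≤ κ' ^ (n - j) * (κ * height j B ^ (n - m)) ^ (n - (m + 1)) := by gcongr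
      _ = κ' ^ (n - j) * κ ^ (n - (m + 1)) * (height j B ^ (n - (m + 1))) ^ (n - m) := by
          rw [mul_pow, ← pow_mul, ← pow_mul, mul_comm (n - m), mul_assoc]
      _ ≤ (κ' ^ (n - j) * κ ^ (n - (m + 1))) ^ (n - m) *
          (height j B ^ (n - (m + 1))) ^ (n - m) := by
          gcongr
          exact le_self_pow₀ hK1 hnm
      _ = _ := by simp only [mul_pow]

/-! ### Dirichlet approximation of a piece of `A`. -/

/-- Dirichlet's theorem on simultaneous approximation. -/
theorem exists_nat_abs_mul_sub_le {ι : Type*} [Fintype ι] (θ : ι → ℝ) {Q : ℕ} (hQ : 0 < Q) :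
    ∃ q : ℕ, 1 ≤ q ∧ q ≤ Q ^ Fintype.card ι ∧ ∀ i, ∃ z : ℤ, |q * θ i - z| ≤ 1 / Q := by
  obtain ⟨x, x', hne, h⟩ := exists_ne_abs_sub_sub_le hQ
    (fun (x : Fin (Q ^ Fintype.card ι + 1)) i => (x : ℕ) * θ i) (Or.inr (by simp))
  have hx := x.2
  have hx' := x'.2
  rcases lt_or_gt_of_ne hne with hlt | hlt
  · have hlt' : (x : ℕ) < x' := hlt
    refine ⟨x' - x, by omega, by omega, fun i => ?_⟩
    obtain ⟨z, hz⟩ := h i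
    refine ⟨-z, ?_⟩
    rw [← abs_neg, Nat.cast_sub hlt'.le]
    convert hz using 2
    push_cast
    ring
  · have hlt' : (x' : ℕ) < x := hlt
    refine ⟨x - x', by omega, by omega, fun i => ?_⟩
    obtain ⟨z, hz⟩ := h i
    refine ⟨z, ?_⟩
    rw [Nat.cast_sub hlt'.le]
    convert hz using 2
    ring

theorem norm_sub_starProjection_le {n : ℕ} (A : Submodule ℝ (EucSp n)) (x : EucSp n)
    {a : EucSp n} (ha : a ∈ A) : ‖x - A.starProjection x‖ ≤ ‖x - a‖ := by
  rw [A.starProjection_minimal]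
  exact ciInf_le ⟨0, by rintro _ ⟨_, rfl⟩; positivity⟩ (⟨a, ha⟩ : A)

/-- Rational subspaces of dimension `j` close to a subspace of `A` of the same dimension. -/
theorem exists_rational_near {n d j : ℕ} {A : Submodule ℝ (EucSp n)}
    (hA : Module.finrank ℝ A = d) (hjd : j ≤ d) : ∃ c : ℝ, 0 < c ∧ ∀ Q : ℕ, 0 < Q →
      ∃ q : ℕ, 1 ≤ q ∧ q ≤ Q ^ (j * (n - d)) ∧ ∃ B ∈ rationalSubspaces n j,
        height j B ≤ c * q ^ j ∧ ∀ x ∈ B, ‖x - A.starProjection x‖ ≤ c / (q * Q) * ‖x‖ := by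
  classical
  obtain ⟨I, hI⟩ := exists_pluckerCoord_ne_zero (Module.finBasisOfFinrankEq ℝ A hA)
  obtain ⟨y, hy⟩ := exists_echelon_basis _ hI
  set Y : ℝ := ∑ k, ∑ i, |(y k : EucSp n) i| with hY
  have hYle : ∀ k i, |(y k : EucSp n) i| ≤ Y := fun k i =>
    (Finset.single_le_sum (f := fun i => |(y k : EucSp n) i|) (fun _ _ => abs_nonneg _)
      (Finset.mem_univ i)).trans
    (Finset.single_le_sum (f := fun k => ∑ i, |(y k : EucSp n) i|)
      (fun _ _ => Finset.sum_nonneg fun _ _ => abs_nonneg _) (Finset.mem_univ k))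
  have hY0 : 0 ≤ Y := Finset.sum_nonneg fun _ _ => Finset.sum_nonneg fun _ _ => abs_nonneg _
  set N : ℝ := (Fintype.card (Fin j ↪o Fin n) : ℝ)
  set c₁ : ℝ := N * (j.factorial * (Y + 1) ^ j) with hc₁
  have hc₁0 : 0 ≤ c₁ := by positivity
  have hc₂0 : (0 : ℝ) ≤ j * n := by positivity
  refine ⟨c₁ + j * n + 1, by positivity, fun Q hQ => ?_⟩
  have hQ1 : (1 : ℝ) ≤ Q := by exact_mod_cast hQ
  let f : Fin j ↪o Fin d := Fin.castLEOrderEmb hjd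
  obtain ⟨q, hq1, hqQ, hz⟩ := exists_nat_abs_mul_sub_le
    (fun p : Fin j × {i : Fin n // i ∉ Set.range I} => (y (f p.1) : EucSp n) p.2) hQ
  rw [Fintype.card_prod, Fintype.card_fin, ← Nat.card_eq_fintype_card,
    card_subtype_notMem_range] at hqQ
  have hq1' : (1 : ℝ) ≤ q := by exact_mod_cast hq1
  have hq0 : (q : ℝ) ≠ 0 := by positivity
  -- On the coordinates in `I` the entries of `q y` are `0` or `q`, hence need no approximation.
  -- Only `n - d` coordinates per vector cost something, and the `p k` inherit the echelon form,
  -- scaled by `q`.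
  have hz' : ∀ k i, ∃ z : ℤ, |q * (y (f k) : EucSp n) i - z| ≤ 1 / Q ∧
      ∀ l, i = I (f l) → z = if k = l then (q : ℤ) else 0 := by
    intro k i
    by_cases hi : i ∈ Set.range I
    · obtain ⟨l, rfl⟩ := hi
      refine ⟨if f k = l then q else 0, ?_, ?_⟩
      · rw [hy]
        split_ifs <;> simp
      · intro l' hl'
        rw [I.injective hl']
        simp [f.injective.eq_iff]
    · obtain ⟨z, hz⟩ := hz (k, ⟨i, hi⟩)
      exact ⟨z, hz, fun l hl => absurd ⟨_, hl.symm⟩ hi⟩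
  choose z hz1 hz2 using hz'
  let p : Fin j → EucSp n := fun k => WithLp.toLp 2 (fun i => (z k i : ℝ))
  have hpI : ∀ k l, p k (I (f l)) = if k = l then (q : ℝ) else 0 := fun k l => by
    simp only [p, hz2 k _ l rfl]
    split_ifs <;> simp
  have hli : LinearIndependent ℝ p :=
    linearIndependent_of_apply_eq (I := fun l => I (f l)) hq0 hpI
  let b := Module.Basis.span hli
  have hb : ∀ k, (b k : EucSp n) = p k := fun k =>
    congrArg Subtype.val (Module.Basis.span_apply hli k)
  refine ⟨q, hq1, hqQ, Submodule.span ℝ (Set.range p), ⟨b, fun k i => ⟨z k i, ?_⟩⟩, ?_, ?_⟩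
  · rw [hb]
    simp [p]
  · have hdet : ∀ J : Fin j ↪o Fin n,
        ((Matrix.det (Matrix.of fun k l : Fin j => z k (J l)) : ℤ) : ℝ) =
        1 * pluckerCoord (fun k => (b k : EucSp n)) J := fun J => by
      simp only [hb, one_mul]
      exact (Int.castRingHom ℝ).map_det _
    refine (height_le b _ (M := (j.factorial * (Y + 1) ^ j) * q ^ j) one_ne_zero hdet
      fun J => ?_).trans ?_
    · rw [one_mul]
      have hent : ∀ k l : Fin j, |(Matrix.of fun k l : Fin j => (b k : EucSp n) (J l)) k l| ≤
          (Y + 1) * q := by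
        intro k l
        have h1 := hz1 k (J l)
        have h2 := hYle (f k) (J l)
        have h3 : (1 : ℝ) / Q ≤ 1 := by rw [div_le_one (by linarith)]; exact hQ1
        have h4 : (Matrix.of fun k l : Fin j => (b k : EucSp n) (J l)) k l = z k (J l) := by
          simp [hb, p]
        have h5 : |(q : ℝ) * (y (f k) : EucSp n) (J l)| ≤ q * Y := by
          rw [abs_mul, Nat.abs_cast]
          gcongr
        rw [h4]
        rw [abs_le] at h1 h5 ⊢
        constructor <;> linarith [h1.1, h1.2, h5.1, h5.2]
      have := Matrix.det_le (abv := AbsoluteValue.abs) hent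
      rw [Fintype.card_fin, nsmul_eq_mul, mul_pow, ← mul_assoc] at this
      exact this
    · rw [← mul_assoc, ← hc₁]
      gcongr
      linarith
  · intro x hx
    have hxs := congrArg Subtype.val (b.sum_repr ⟨x, hx⟩)
    simp only [Submodule.coe_sum, Submodule.coe_smul, hb] at hxs
    set a := b.repr ⟨x, hx⟩
    -- The echelon form bounds the coefficients by `‖x‖ / q`, which is the source of the factor
    -- `1/q` in the distance to `A`.
    have ha : ∀ l, a l = x (I (f l)) / q := fun l => by
      rw [eq_div_iff hq0, ← hxs, apply_sum_smul]
      simp [hpI]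
    have hmem : ∑ k, a k • ((q : ℝ) • (y (f k) : EucSp n)) ∈ A :=
      A.sum_mem fun k _ => A.smul_mem _ (A.smul_mem _ (y (f k)).2)
    refine (norm_sub_starProjection_le A x hmem).trans ?_
    have hpk : ∀ k, ‖p k - (q : ℝ) • (y (f k) : EucSp n)‖ ≤ n * (1 / Q) := fun k => by
      rw [EuclideanSpace.norm_eq]
      simp only [Real.norm_eq_abs, sq_abs]
      have := sqrt_sum_sq_le (fun i => (p k - (q : ℝ) • (y (f k) : EucSp n)) i)
        (M := 1 / Q) fun i => by
          rw [PiLp.sub_apply, abs_sub_comm]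
          exact hz1 k i
      rwa [Fintype.card_fin] at this
    calc ‖x - ∑ k, a k • ((q : ℝ) • (y (f k) : EucSp n))‖
        = ‖∑ k, a k • (p k - (q : ℝ) • (y (f k) : EucSp n))‖ := by
          conv_lhs => rw [← hxs]
          rw [← Finset.sum_sub_distrib]
          simp only [smul_sub]
      _ ≤ ∑ k, ‖a k • (p k - (q : ℝ) • (y (f k) : EucSp n))‖ := norm_sum_le _ _
      _ ≤ ∑ _k : Fin j, ‖x‖ / q * (n * (1 / Q)) := by
          refine Finset.sum_le_sum fun k _ => ?_
          rw [norm_smul]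
          refine mul_le_mul ?_ (hpk k) (norm_nonneg _) (by positivity)
          rw [ha, norm_div, Real.norm_natCast]
          gcongr
          exact PiLp.norm_apply_le x _
      _ = j * n / (q * Q) * ‖x‖ := by
          simp only [Finset.sum_const, Finset.card_univ, Fintype.card_fin, nsmul_eq_mul]
          field_simp
      _ ≤ _ := by
          gcongr
          linarith

/-! ### Infinitely many approximations and the final exponent. -/

/-- There are infinitely many approximations of exponent `γ` when `γ` is smaller than the exponent
produced by Dirichlet's theorem for `j * (n - d)` numbers followed by going up. -/
theorem infinite_setOf_psi_le {n d e j : ℕ} {A : Submodule ℝ (EucSp n)}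
    (hA : A ∈ irrationalSubspaces n d e j) (hj : 1 ≤ j) (hjd : j ≤ d) (hje : j ≤ e) (hen : e < n)
    {γ N : ℝ} (hγ : 0 < γ) (hN : (j * (n - d) : ℕ) < N)
    (hγN : γ * (j * (n - e : ℕ)) = (n - j : ℕ) * (1 + 1 / N)) :
    {B ∈ rationalSubspaces n e | psi j A B ≤ 1 / height e B ^ γ}.Infinite := by
  intro hfin
  obtain ⟨hAd, hAirr⟩ := hA
  obtain ⟨c, hc, hnear⟩ := exists_rational_near hAd hjd
  obtain ⟨κ, hκ, hup⟩ := exists_rational_of_le hje hen.le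
  choose η hη0 hη using exists_pos_le_norm_sub_starProjection A
  have hN0 : 0 < N := (Nat.cast_nonneg _).trans_lt hN
  set M : ℝ := ((j * (n - d) : ℕ) : ℝ) with hM
  set c₃ : ℝ := (κ * c ^ (n - e)) ^ (γ / (n - j : ℕ)) with hc₃
  have ev1 : ∀ᶠ Q : ℕ in Filter.atTop,
      ∀ C ∈ {B ∈ rationalSubspaces n e | psi j A B ≤ 1 / height e B ^ γ}, c / Q < η C := by
    rw [Filter.eventually_all_finite hfin]
    intro C _
    exact (tendsto_const_div_atTop_nhds_zero_nat c).eventually (gt_mem_nhds (hη0 C))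
  -- Here `M < N` is used: `q^{1/N} ≤ Q^{M/N}` leaves a positive power of `Q` to absorb the
  -- constants.
  have ev2 : ∀ᶠ Q : ℕ in Filter.atTop, c * c₃ ≤ (Q : ℝ) ^ (1 - M / N) := by
    have hpos : 0 < 1 - M / N := by
      rw [sub_pos, div_lt_one hN0]
      exact hN
    exact ((tendsto_rpow_atTop hpos).comp tendsto_natCast_atTop_atTop).eventually_ge_atTop _
  obtain ⟨Q, hQ1, hQ2, hQ0⟩ := (ev1.and (ev2.and (Filter.eventually_gt_atTop 0))).exists
  obtain ⟨q, hq1, hqQ, B, hB, hBH, hBA⟩ := hnear Q hQ0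
  obtain ⟨C, hC, hBC, hCH⟩ := hup B hB
  have hBj := mem_rationalSubspaces_finrank hB
  have hQ : (0 : ℝ) < Q := by exact_mod_cast hQ0
  have hq : (1 : ℝ) ≤ q := by exact_mod_cast hq1
  have hq0 : (0 : ℝ) < q := by linarith
  have hnj : (0 : ℝ) < (n - j : ℕ) := by
    have : 0 < n - j := by omega
    exact_mod_cast this
  have hHC : 0 < height e C := zero_lt_one.trans_le (one_le_height hC)
  have hHB : 0 < height j B := zero_lt_one.trans_le (one_le_height hB)
  -- `H(C) ≪ q^{j(n-e)/(n-j)}`, and `hγN` says precisely that `γ` turns this exponent into `1 +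
  -- 1/N`.
  have hpow : height e C ^ γ ≤ c₃ * (q : ℝ) ^ (1 + 1 / N) := by
    have h1 : height e C ^ (n - j) ≤ (κ * c ^ (n - e)) * (q : ℝ) ^ (j * (n - e)) := by
      refine hCH.trans ?_
      rw [mul_assoc, pow_mul, ← mul_pow]
      gcongr
    have e1 : height e C ^ γ = (height e C ^ (n - j)) ^ (γ / (n - j : ℕ)) := by
      rw [← Real.rpow_natCast, ← Real.rpow_mul hHC.le, mul_div_cancel₀ _ hnj.ne']
    have e2 : ((q : ℝ) ^ (j * (n - e))) ^ (γ / (n - j : ℕ)) = (q : ℝ) ^ (1 + 1 / N) := by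
      rw [← Real.rpow_natCast, ← Real.rpow_mul hq0.le]
      congr 1
      rw [mul_div_assoc', div_eq_iff hnj.ne', Nat.cast_mul, mul_comm, hγN, mul_comm]
    rw [e1, hc₃, ← e2, ← Real.mul_rpow (by positivity) (by positivity)]
    exact Real.rpow_le_rpow (by positivity) h1 (by positivity)
  have hqN : (q : ℝ) ^ (1 / N) ≤ (Q : ℝ) ^ (M / N) := by
    have h1 : (q : ℝ) ≤ (Q : ℝ) ^ M := by
      rw [hM, Real.rpow_natCast]
      exact_mod_cast hqQ
    calc (q : ℝ) ^ (1 / N) ≤ ((Q : ℝ) ^ M) ^ (1 / N) :=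
          Real.rpow_le_rpow hq0.le h1 (by positivity)
      _ = (Q : ℝ) ^ (M / N) := by rw [← Real.rpow_mul hQ.le, mul_one_div]
  have hkey : c * height e C ^ γ ≤ q * Q := by
    have hc₃0 : 0 ≤ c₃ := by positivity
    calc c * height e C ^ γ ≤ c * (c₃ * (q : ℝ) ^ (1 + 1 / N)) := by gcongr
      _ = q * ((c * c₃) * (q : ℝ) ^ (1 / N)) := by
          rw [Real.rpow_add hq0, Real.rpow_one]
          ring
      _ ≤ q * ((Q : ℝ) ^ (1 - M / N) * (Q : ℝ) ^ (M / N)) := by gcongr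
      _ = q * Q := by rw [← Real.rpow_add hQ, sub_add_cancel, Real.rpow_one]
  have hCS : C ∈ {B ∈ rationalSubspaces n e | psi j A B ≤ 1 / height e B ^ γ} := by
    refine ⟨hC, (psi_le hj (hAd ▸ hjd) hBj hBC hBA).trans ?_⟩
    rw [div_le_div_iff₀ (by positivity) (by positivity), one_mul]
    exact hkey
  -- `C` lies in the supposedly finite set, yet by irrationality it has a vector orthogonal to `A ∩
  -- C` at relative distance at most `c/Q` from `A`, below the bound `η C`.
  obtain ⟨y, hyB, hyo, hy0⟩ := exists_mem_orthogonal_ne_zero B (A ⊓ C)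
    (by rw [hBj]; exact hAirr C hC)
  have hyn : 0 < ‖y‖ := norm_pos_iff.2 hy0
  have h1 := (hη C y (hBC hyB) hyo).trans (hBA y hyB)
  have h2 := le_of_mul_le_mul_right h1 hyn
  have h3 : c / (q * Q) ≤ c / Q := by
    gcongr
    exact le_mul_of_one_le_left hQ.le hq
  exact absurd (hQ1 C hCS) (not_lt.2 (h2.trans h3))

theorem mainTheorem5 (n d e j : ℕ) (hn : 4 ≤ n) (hde : d + e ≤ n) (hj : 1 ≤ j)
    (hjde : j ≤ min d e) :
    ((((n : ℝ) - j) * (j * n - j * d + (j : ℝ) ^ 2 / 2 + (j : ℝ) / 2 + 1) /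
        ((j : ℝ) ^ 2 * ((n : ℝ) - e) * ((n : ℝ) - d + (j : ℝ) / 2 + 1 / 2)) : ℝ) : EReal)
      ≤ muRing n d e j := by
  obtain ⟨hjd, hje⟩ := le_min_iff.1 hjde
  have h1 : (1 : ℝ) ≤ j := by exact_mod_cast hj
  have h2 : (j : ℝ) < n := by exact_mod_cast (by omega : j < n)
  have h3 : (d : ℝ) < n := by exact_mod_cast (by omega : d < n)
  have h4 : (e : ℝ) < n := by exact_mod_cast (by omega : e < n)
  have hj0 : (0 : ℝ) < j := by linarith
  have p1 : 0 < (n : ℝ) - j := by linarith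
  have p2 : 0 < (n : ℝ) - e := by linarith
  have p3 : 0 < (n : ℝ) - d := by linarith
  have p4 : 0 < (j : ℝ) * n - j * d + (j : ℝ) ^ 2 / 2 + (j : ℝ) / 2 + 1 := by
    have : 0 < (j : ℝ) * (n - d) := by positivity
    nlinarith
  have p5 : 0 < (n : ℝ) - d + (j : ℝ) / 2 + 1 / 2 := by linarith
  refine le_sInf ?_
  rintro _ ⟨A, hA, rfl⟩
  have hγ : 0 < ((n : ℝ) - j) * (j * n - j * d + (j : ℝ) ^ 2 / 2 + (j : ℝ) / 2 + 1) /
      ((j : ℝ) ^ 2 * ((n : ℝ) - e) * ((n : ℝ) - d + (j : ℝ) / 2 + 1 / 2)) := by positivity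
  -- This `N` equals `j(n-d) + j(j+1)/2`, the value for which `(n-j)(1+1/N)/(j(n-e))` is the stated
  -- bound.
  refine le_sSup ⟨_, hγ, infinite_setOf_psi_le hA hj hjd hje (by omega) hγ
    (N := j * ((n : ℝ) - d + (j : ℝ) / 2 + 1 / 2)) ?_ ?_, rfl⟩
  · rw [Nat.cast_mul, Nat.cast_sub (by omega)]
    exact mul_lt_mul_of_pos_left (by linarith) hj0
  · rw [Nat.cast_sub (by omega), Nat.cast_sub (by omega)]
    field_simp
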